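/- All Banach spaces are over $\mathbb{K}$, where $\mathbb{K}=\mathbb{R}$ or $\mathbb{K}=\mathbb{C}$. Let $\mathbb{D}$ be the open unit disc of $\mathbb{C}$. A Banach space $E$ has the \emph{Radon--Nikodym property} if for every bounded harmonic function $f:\mathbb{D}\to E$ the radial limit $\lim_{r\to 1^-} f(re^{it})$ exists in the norm of $E$ for almost every $t\in[0,2\pi]$. A Banach space $E$ is \emph{weakly LUR} (weakly locally uniformly rotund) if for every $x\in E$ and every bounded sequence $(x_n)_{n\ge 1}$ in $E$ with $$\frac{\|x_n\|^2}{2}+\frac{\|x\|^2}{2}-\left\|\frac{x_n+x}{2}\right\|^2\longrightarrow 0 \quad (n\to\infty),$$ one has $x_n\to x$ weakly in $E$. Let $\mathcal{L}(X,Y)$ be the Banach space of bounded linear operators from $X$ to $Y$, with the operator norm. \textbf{Theorem.} Let $X$ be a separable Banach space and let $Y$ be a Banach space with the Radon--Nikodym property. If $\mathcal{L}(X,Y)$ is weakly LUR, then $\mathcal{L}(X,Y)$ has the Radon--Nikodym property. -/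

import Mathlib

open MeasureTheory Filter Topology

/-- The space `h^∞(𝔻, E)`: the bounded harmonic functions on the open unit disc with values in `E`.
A function on `𝔻` is represented by a function on `ℂ`, whose values outside `𝔻` play no role.
Harmonicity is with respect to the real structure underlying `E`. -/
def IsBoundedHarmonicOnDisc (𝕜 : Type*) [RCLike 𝕜] {E : Type*} [NormedAddCommGroup E]
    [NormedSpace 𝕜 E] (f : ℂ → E) : Prop :=
  letI : NormedSpace ℝ E := NormedSpace.restrictScalars ℝ 𝕜 E
  InnerProductSpace.HarmonicOnNhd f (Metric.ball (0 : ℂ) 1) ∧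
    ∃ C : ℝ, ∀ z ∈ Metric.ball (0 : ℂ) 1, ‖f z‖ ≤ C

/-- `T` is a Radon-Nikodym operator: for every bounded harmonic `f : 𝔻 → E`, the limit of
`T (f (r e^{it}))` as `r → 1⁻` exists in norm, for almost every `t` (the circle is parametrized by
`t ∈ (0, 2π]`; `circleMap 0 r t = r e^{it}`). -/
def IsRadonNikodymOperator {𝕜 : Type*} [RCLike 𝕜] {E F : Type*} [NormedAddCommGroup E]
    [NormedSpace 𝕜 E] [NormedAddCommGroup F] [NormedSpace 𝕜 F] (T : E →L[𝕜] F) : Prop :=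
  ∀ f : ℂ → E, IsBoundedHarmonicOnDisc 𝕜 f →
    ∀ᵐ t : ℝ ∂(volume.restrict (Set.Ioc 0 (2 * Real.pi))),
      ∃ y : F, Tendsto (fun r : ℝ => T (f (circleMap 0 r t))) (𝓝[<] 1) (𝓝 y)

/-- `E` has the Radon-Nikodym property: its identity is a Radon-Nikodym operator. -/
def HasRadonNikodymProperty (𝕜 : Type*) [RCLike 𝕜] (E : Type*) [NormedAddCommGroup E]
    [NormedSpace 𝕜 E] : Prop :=
  IsRadonNikodymOperator (ContinuousLinearMap.id 𝕜 E)

/-- `V` is a weakly LUR operator: whenever `(xₙ)` is a bounded sequence with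
`‖xₙ‖² / 2 + ‖x‖² / 2 - ‖(xₙ + x) / 2‖² → 0`, the sequence `V xₙ` converges weakly to `V x`. -/
def IsWeaklyLUROperator {𝕜 : Type*} [RCLike 𝕜] {E F : Type*} [NormedAddCommGroup E]
    [NormedSpace 𝕜 E] [NormedAddCommGroup F] [NormedSpace 𝕜 F] (V : E →L[𝕜] F) : Prop :=
  ∀ (x : E) (u : ℕ → E), (∃ C : ℝ, ∀ n, ‖u n‖ ≤ C) →
    Tendsto (fun n => ‖u n‖ ^ 2 / 2 + ‖x‖ ^ 2 / 2 - ‖(2 : 𝕜)⁻¹ • (u n + x)‖ ^ 2) atTop (𝓝 0) →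
    ∀ φ : StrongDual 𝕜 F, Tendsto (fun n => φ (V (u n))) atTop (𝓝 (φ (V x)))

/-- `E` is weakly LUR (weakly locally uniformly rotund): its identity is a weakly LUR operator. -/
def IsWeaklyLUR (𝕜 : Type*) [RCLike 𝕜] (E : Type*) [NormedAddCommGroup E]
    [NormedSpace 𝕜 E] : Prop :=
  IsWeaklyLUROperator (ContinuousLinearMap.id 𝕜 E)

/-!
# The Radon-Nikodym property of spaces of operators

Let `f` be a bounded harmonic function on the disc with values in `X →L[𝕜] Y`. As `Y` has the
Radon-Nikodym property and `X` is separable, the radial limits `F t` of `f` exist for almost every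
`t` in the strong operator topology (`ae_exists_tendsto_apply`).

The norms converge as well: `‖f (r e^{it})‖ → ‖F t‖` for almost every `t`
(`ae_tendsto_norm_of_radial_limit_apply`). The lower bound is the semicontinuity of the operator
norm. For the upper bound, `‖f‖` is dominated by the Poisson integral of `‖F‖`
(`InnerProductSpace.HarmonicOnNhd.norm_le_integral_unitPoissonKernel_mul`, applied to each orbit
`f z x`), and Fatou's theorem gives the radial limits of this scalar Poisson integral
(`ae_tendsto_integral_unitPoissonKernel_mul`).

Strong operator convergence together with convergence of the norms forces
`‖f (r e^{it}) + F t‖ → 2 ‖F t‖`, so weak local uniform rotundity yields `f (r e^{it}) → F t` weakly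
along sequences `r → 1`. Hence `F t` lies in the closed linear span `Z` of the values of `f`, which
is norm separable.

Finally, let `D` be a countable set whose closure contains `Z`. The convergence of norms applies to
`f - A` for every `A ∈ D`, so that almost everywhere `‖f (r e^{it}) - A‖ → ‖F t - A‖` for all
`A ∈ D` at once. Taking `A` close to `F t` gives norm convergence of `f (r e^{it})` to `F t`.
-/

/-! ### Radial limits of Poisson integrals -/

/-- The Poisson kernel of the unit disc in polar form: `unitPoissonKernel r s` is the value at
`r e^{it}` and the boundary point `e^{i(t+s)}`. -/
noncomputable def unitPoissonKernel (r s : ℝ) : ℝ :=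
  (1 - r ^ 2) / (1 - 2 * r * Real.cos s + r ^ 2)

lemma unitPoissonKernel_denom_eq (r s : ℝ) :
    1 - 2 * r * Real.cos s + r ^ 2 = (1 - r) ^ 2 + 4 * r * Real.sin (s / 2) ^ 2 := by
  have h : Real.cos s = 1 - 2 * Real.sin (s / 2) ^ 2 := by
    rw [Real.sin_sq_eq_half_sub]; ring_nf
  rw [h]; ring

lemma unitPoissonKernel_denom_pos {r : ℝ} (hr : 0 ≤ r) (hr1 : r < 1) (s : ℝ) :
    0 < 1 - 2 * r * Real.cos s + r ^ 2 := by
  rw [unitPoissonKernel_denom_eq]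
  have := sub_pos.2 hr1
  positivity

lemma unitPoissonKernel_nonneg {r : ℝ} (hr : 0 ≤ r) (hr1 : r < 1) (s : ℝ) :
    0 ≤ unitPoissonKernel r s :=
  div_nonneg (by nlinarith) (unitPoissonKernel_denom_pos hr hr1 s).le

/-- The Poisson kernel is invariant under dilations of the disc. -/
lemma poissonKernel_circleMap_mul {ρ : ℝ} (hρ : ρ ≠ 0) (r t θ : ℝ) :
    poissonKernel 0 (circleMap 0 (ρ * r) t) (circleMap 0 ρ θ) = unitPoissonKernel r (θ - t) := by
  rw [poissonKernel_def, unitPoissonKernel, Real.cos_sub,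
    ← mul_div_mul_left (1 - r ^ 2) _ (pow_ne_zero 2 hρ)]
  simp only [sub_zero, ← Complex.normSq_eq_norm_sq, Complex.normSq_apply, circleMap,
    Complex.exp_mul_I, zero_add, ← Complex.ofReal_cos, ← Complex.ofReal_sin]
  simp only [Complex.mul_re, Complex.mul_im, Complex.add_re, Complex.add_im, Complex.sub_re,
    Complex.sub_im, Complex.ofReal_re, Complex.ofReal_im, Complex.I_re, Complex.I_im]
  congr 1
  · linear_combination ρ ^ 2 * Real.sin_sq_add_cos_sq θ - (ρ * r) ^ 2 * Real.sin_sq_add_cos_sq t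
  · linear_combination ρ ^ 2 * Real.sin_sq_add_cos_sq θ + (ρ * r) ^ 2 * Real.sin_sq_add_cos_sq t

lemma poissonKernel_circleMap (r t θ : ℝ) :
    poissonKernel 0 (circleMap 0 r t) (circleMap 0 1 θ) = unitPoissonKernel r (θ - t) := by
  simpa using poissonKernel_circleMap_mul one_ne_zero r t θ

lemma hasDerivAt_unitPoissonKernel {r : ℝ} (hr : 0 ≤ r) (hr1 : r < 1) (s : ℝ) :
    HasDerivAt (unitPoissonKernel r)
      (-((1 - r ^ 2) * (2 * r * Real.sin s)) / (1 - 2 * r * Real.cos s + r ^ 2) ^ 2) s := by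
  have h : HasDerivAt (fun s => 1 - 2 * r * Real.cos s + r ^ 2) (2 * r * Real.sin s) s := by
    have := (((Real.hasDerivAt_cos s).const_mul (2 * r)).const_sub 1).add_const (r ^ 2)
    exact this.congr_deriv (by ring)
  have := (hasDerivAt_const s (1 - r ^ 2)).div h (unitPoissonKernel_denom_pos hr hr1 s).ne'
  exact this.congr_deriv (by ring)

lemma contDiff_unitPoissonKernel {r : ℝ} (hr : 0 ≤ r) (hr1 : r < 1) :
    ContDiff ℝ 1 (unitPoissonKernel r) := by
  unfold unitPoissonKernel
  exact contDiff_const.div (by fun_prop) fun s => (unitPoissonKernel_denom_pos hr hr1 s).ne'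

lemma circleMap_mem_unit_ball {r : ℝ} (hr : 0 ≤ r) (hr1 : r < 1) (t : ℝ) :
    circleMap 0 r t ∈ Metric.ball (0 : ℂ) 1 := by
  simp [abs_of_nonneg hr, hr1]

lemma integral_unitPoissonKernel {r : ℝ} (hr : 0 ≤ r) (hr1 : r < 1) (t : ℝ) :
    ∫ θ in (0 : ℝ)..2 * Real.pi, unitPoissonKernel r (θ - t) = 2 * Real.pi := by
  have h := InnerProductSpace.HarmonicOnNhd.circleAverage_poissonKernel_smul
    (InnerProductSpace.harmonicOnNhd_const (s := Metric.closedBall (0 : ℂ) 1) (1 : ℝ))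
    (circleMap_mem_unit_ball hr hr1 t)
  simp only [Real.circleAverage_def, Pi.mul_def, poissonKernel_circleMap, smul_eq_mul,
    mul_one] at h
  have := Real.pi_pos
  field_simp at h
  linarith

/-- On a period, `|sin ((θ - t) / 2)|` dominates a multiple of `|θ - t|`: for `t` in the open
period the other zeros of the sine stay at a positive distance. -/
lemma exists_mul_sq_le_sin_sq {t : ℝ} (ht : t ∈ Set.Ioo 0 (2 * Real.pi)) :
    ∃ c > 0, ∀ θ ∈ Set.Icc 0 (2 * Real.pi),
      c * (θ - t) ^ 2 ≤ Real.sin ((θ - t) / 2) ^ 2 := by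
  have hpi := Real.pi_pos
  obtain ⟨θ₀, hθ₀, hmin⟩ := (isCompact_Icc (a := (0 : ℝ)) (b := 2 * Real.pi)).exists_isMinOn
    ⟨0, by simp [hpi.le]⟩
    (f := fun θ => Real.sinc ((θ - t) / 2) ^ 2)
    ((Real.continuous_sinc.comp (by fun_prop)).pow 2).continuousOn
  have key : ∀ θ : ℝ, Real.sin ((θ - t) / 2) = Real.sinc ((θ - t) / 2) * ((θ - t) / 2) := by
    intro θ
    by_cases h : (θ - t) / 2 = 0
    · simp [h]
    · rw [Real.sinc_of_ne_zero h, div_mul_cancel₀ _ h]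
  refine ⟨Real.sinc ((θ₀ - t) / 2) ^ 2 / 4, ?_, fun θ hθ => ?_⟩
  · have : Real.sinc ((θ₀ - t) / 2) ≠ 0 := by
      by_cases h : (θ₀ - t) / 2 = 0
      · simp [h]
      · rw [Real.sinc_of_ne_zero h]
        refine div_ne_zero ?_ h
        rw [Ne, Real.sin_eq_zero_iff_of_lt_of_lt]
        · exact h
        · linarith [hθ₀.1, ht.2]
        · linarith [hθ₀.2, ht.1]
    positivity
  · rw [key]
    have := hmin hθ
    simp only [Set.mem_ofPred_eq] at this
    nlinarith [mul_le_mul_of_nonneg_right this (sq_nonneg (θ - t))]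

/-- The quantitative core of Fatou's theorem. If the primitive of `g` based at `t` has derivative
zero at `t`, then the Poisson integrals of `g` tend to zero along the radius at `t`. Integration by
parts moves the derivative to the kernel, and `|θ - t| * |P'| ≤ C * P`. -/
lemma exists_abs_integral_unitPoissonKernel_mul_le {g : ℝ → ℝ} {t : ℝ}
    (hg : IntervalIntegrable g volume 0 (2 * Real.pi)) (ht : t ∈ Set.Ioo 0 (2 * Real.pi))
    (hd : HasDerivAt (fun θ => ∫ s in t..θ, g s) 0 t) :
    ∃ c : ℝ, ∀ ε > 0, ∃ B : ℝ, ∀ r : ℝ, 1 / 2 ≤ r → r < 1 →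
      |∫ θ in (0 : ℝ)..2 * Real.pi, unitPoissonKernel r (θ - t) * g θ| ≤
        c * ε + B * (1 - r ^ 2) := by
  have hpi := Real.pi_pos
  have h2pi : (0 : ℝ) ≤ 2 * Real.pi := by positivity
  obtain ⟨c, hc, hcs⟩ := exists_mul_sq_le_sin_sq ht
  have htm : t ∈ Set.uIcc 0 (2 * Real.pi) := by
    rw [Set.uIcc_of_le h2pi]; exact ⟨ht.1.le, ht.2.le⟩
  set H : ℝ → ℝ := fun θ => ∫ s in t..θ, g s with hH
  have hHac : AbsolutelyContinuousOnInterval H 0 (2 * Real.pi) :=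
    hg.absolutelyContinuousOnInterval_intervalIntegral htm
  have hHd : ∀ᵐ θ, θ ∈ Set.uIcc 0 (2 * Real.pi) → deriv H θ = g θ := by
    filter_upwards [hg.ae_hasDerivAt_integral] with θ hθ hm
    exact (hθ hm t htm).deriv
  have hHc : ContinuousOn H (Set.uIcc 0 (2 * Real.pi)) := hHac.continuousOn
  obtain ⟨K, hK⟩ := isCompact_uIcc.exists_bound_of_continuousOn hHc
  rw [Set.uIcc_of_le h2pi] at hK
  have hK0 : 0 ≤ K := (norm_nonneg _).trans (hK t ⟨ht.1.le, ht.2.le⟩)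
  refine ⟨2 * Real.pi / c, fun ε hε => ?_⟩
  -- A bound for the primitive valid on the whole period: linear with a small constant near `t`,
  -- and cubic, which is harmless, away from `t`.
  obtain ⟨K', hK'0, hK'⟩ : ∃ K' : ℝ, 0 ≤ K' ∧ ∀ θ ∈ Set.Icc 0 (2 * Real.pi),
      |H θ| ≤ ε * |θ - t| + K' * |θ - t| ^ 3 := by
    have hlo := (hasDerivAt_iff_isLittleO.1 hd).def hε
    obtain ⟨δ, hδ, hδH⟩ := Metric.eventually_nhds_iff.1 hlo
    refine ⟨K / δ ^ 3, by positivity, fun θ hθ => ?_⟩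
    by_cases h : |θ - t| < δ
    · have := hδH (y := θ) (by rwa [Real.dist_eq])
      have hHt : H t = 0 := intervalIntegral.integral_same
      simp only [hHt, sub_zero, smul_zero, Real.norm_eq_abs] at this
      have h2 : 0 ≤ K / δ ^ 3 * |θ - t| ^ 3 := by positivity
      linarith
    · have h1 : K ≤ K / δ ^ 3 * |θ - t| ^ 3 := by
        rw [div_mul_eq_mul_div, le_div_iff₀ (by positivity)]
        gcongr
        exact not_lt.1 h
      have h2 : 0 ≤ ε * |θ - t| := by positivity
      have := hK θ hθ
      rw [Real.norm_eq_abs] at this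
      linarith
  refine ⟨2 * K / (2 * c * t ^ 2) + 2 * Real.pi * (K' / (2 * c ^ 2)), fun r hr hr1 => ?_⟩
  have hr0 : 0 ≤ r := by linarith
  have h1r : 0 ≤ 1 - r ^ 2 := by nlinarith
  have hDpos := unitPoissonKernel_denom_pos hr0 hr1
  -- As `1 / 2 ≤ r`, the coefficient `4 * r` of the squared sine in the denominator is at least `2`.
  have hD : ∀ θ ∈ Set.Icc 0 (2 * Real.pi),
      2 * c * (θ - t) ^ 2 ≤ 1 - 2 * r * Real.cos (θ - t) + r ^ 2 := by
    intro θ hθ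
    rw [unitPoissonKernel_denom_eq]
    have h0 := hcs θ hθ
    nlinarith [sq_nonneg (1 - r), sq_nonneg (Real.sin ((θ - t) / 2))]
  have hPd : ∀ θ, HasDerivAt (fun θ => unitPoissonKernel r (θ - t))
      (-((1 - r ^ 2) * (2 * r * Real.sin (θ - t))) /
        (1 - 2 * r * Real.cos (θ - t) + r ^ 2) ^ 2) θ := fun θ => by
    simpa using (hasDerivAt_unitPoissonKernel hr0 hr1 (θ - t)).comp_sub_const θ t
  have hPsm : ContDiff ℝ 1 (fun θ => unitPoissonKernel r (θ - t)) :=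
    (contDiff_unitPoissonKernel hr0 hr1).comp (by fun_prop)
  have hPac : AbsolutelyContinuousOnInterval (fun θ => unitPoissonKernel r (θ - t))
      0 (2 * Real.pi) := hPsm.contDiffOn.absolutelyContinuousOnInterval
  have hparts := hPac.integral_mul_deriv_eq_deriv_mul hHac
  have hcongr : ∫ θ in (0 : ℝ)..2 * Real.pi, unitPoissonKernel r (θ - t) * deriv H θ =
      ∫ θ in (0 : ℝ)..2 * Real.pi, unitPoissonKernel r (θ - t) * g θ := by
    apply intervalIntegral.integral_congr_ae
    filter_upwards [hHd] with θ hθ hm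
    rw [hθ (Set.uIoc_subset_uIcc hm)]
  rw [← hcongr, hparts]
  -- At both ends of the period the cosine in the kernel equals `cos t`, so the kernel is `O(1 - r ^ 2)`.
  have hend : ∀ θ ∈ Set.Icc 0 (2 * Real.pi), Real.cos (θ - t) = Real.cos t →
      |unitPoissonKernel r (θ - t) * H θ| ≤ K / (2 * c * t ^ 2) * (1 - r ^ 2) := by
    intro θ hθ hcos
    have h0 : 2 * c * t ^ 2 ≤ 1 - 2 * r * Real.cos t + r ^ 2 := by
      simpa using hD 0 ⟨le_rfl, h2pi⟩
    have ht0 := ht.1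
    have hP : unitPoissonKernel r (θ - t) ≤ (1 - r ^ 2) / (2 * c * t ^ 2) := by
      rw [unitPoissonKernel, hcos]
      gcongr
    rw [abs_mul, abs_of_nonneg (unitPoissonKernel_nonneg hr0 hr1 _)]
    calc _ ≤ (1 - r ^ 2) / (2 * c * t ^ 2) * K := by
          gcongr
          exact hK θ hθ
      _ = _ := by ring
  have hint : |∫ θ in (0 : ℝ)..2 * Real.pi, deriv (fun θ => unitPoissonKernel r (θ - t)) θ * H θ| ≤
      ∫ θ in (0 : ℝ)..2 * Real.pi,
        (ε / c * unitPoissonKernel r (θ - t) + K' / (2 * c ^ 2) * (1 - r ^ 2)) := by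
    rw [← Real.norm_eq_abs]
    refine intervalIntegral.norm_integral_le_of_norm_le h2pi (Eventually.of_forall fun θ hθ => ?_) ?_
    · have hθ' : θ ∈ Set.Icc 0 (2 * Real.pi) := ⟨hθ.1.le, hθ.2⟩
      rw [(hPd θ).deriv, Real.norm_eq_abs, abs_mul, abs_div, abs_neg, abs_mul, abs_mul,
        abs_of_nonneg h1r, abs_of_nonneg (by linarith : 0 ≤ 2 * r), abs_pow,
        abs_of_pos (hDpos (θ - t)), unitPoissonKernel]
      have hs : |Real.sin (θ - t)| ≤ |θ - t| := Real.abs_sin_le_abs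
      have hHb := hK' θ hθ'
      have hDθ := hD θ hθ'
      have hDp := hDpos (θ - t)
      set D := 1 - 2 * r * Real.cos (θ - t) + r ^ 2
      rw [← sq_abs (θ - t)] at hDθ
      set a := |θ - t|
      have ha : 0 ≤ a := abs_nonneg _
      calc (1 - r ^ 2) * (2 * r * |Real.sin (θ - t)|) / D ^ 2 * |H θ|
          ≤ (1 - r ^ 2) * (2 * 1 * a) / D ^ 2 * (ε * a + K' * a ^ 3) := by gcongr
        _ = ε * (1 - r ^ 2) * (2 * a ^ 2) / D ^ 2 + K' * (1 - r ^ 2) * (2 * (a ^ 2) ^ 2) / D ^ 2 := by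
            ring
        _ ≤ ε * (1 - r ^ 2) * (D / c) / D ^ 2 +
            K' * (1 - r ^ 2) * (2 * (D / (2 * c)) ^ 2) / D ^ 2 := by
            have h1 : a ^ 2 ≤ D / (2 * c) := by
              rw [le_div_iff₀ (by positivity)]; linarith
            have h2 : 2 * a ^ 2 ≤ D / c := by
              rw [le_div_iff₀ (by positivity)]; linarith
            gcongr
        _ = _ := by field_simp
    · exact (Continuous.intervalIntegrable (by
        have := hPsm.continuous
        fun_prop) _ _)
  have hval : ∫ θ in (0 : ℝ)..2 * Real.pi,
        (ε / c * unitPoissonKernel r (θ - t) + K' / (2 * c ^ 2) * (1 - r ^ 2)) =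
      2 * Real.pi / c * ε + 2 * Real.pi * (K' / (2 * c ^ 2)) * (1 - r ^ 2) := by
    rw [intervalIntegral.integral_add ((hPsm.continuous.intervalIntegrable _ _).const_mul _)
      (by simp), intervalIntegral.integral_const_mul, integral_unitPoissonKernel hr0 hr1]
    simp
    ring
  have he1 := hend (2 * Real.pi) ⟨h2pi, le_rfl⟩ (Real.cos_two_pi_sub t)
  have he0 := hend 0 ⟨le_rfl, h2pi⟩ (by simp)
  rw [hval] at hint
  calc _ ≤ |unitPoissonKernel r (2 * Real.pi - t) * H (2 * Real.pi)| +
        |unitPoissonKernel r (0 - t) * H 0| + |_| :=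
        (abs_sub _ _).trans (by gcongr; exact abs_sub _ _)
    _ ≤ _ := by
      refine (add_le_add (add_le_add he1 he0) hint).trans (le_of_eq ?_)
      ring

/-- **Fatou's theorem** for Poisson integrals of integrable functions: the radial limits exist
almost everywhere and recover the function. -/
theorem ae_tendsto_integral_unitPoissonKernel_mul {h : ℝ → ℝ}
    (hh : IntervalIntegrable h volume 0 (2 * Real.pi)) :
    ∀ᵐ t ∂(volume.restrict (Set.Ioc 0 (2 * Real.pi))),
      Tendsto (fun r : ℝ => ∫ θ in (0 : ℝ)..2 * Real.pi, unitPoissonKernel r (θ - t) * h θ)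
        (𝓝[<] 1) (𝓝 (2 * Real.pi * h t)) := by
  have h2pi : (0 : ℝ) ≤ 2 * Real.pi := by positivity
  rw [ae_restrict_iff' measurableSet_Ioc]
  -- The bounds on the kernel need `t` inside the period, so its right end point is discarded.
  have hne : ∀ᵐ t : ℝ, t ≠ 2 * Real.pi := by simp [ae_iff, measure_singleton]
  filter_upwards [hh.ae_hasDerivAt_integral, hne] with t hd hne ht
  have ht' : t ∈ Set.Ioo 0 (2 * Real.pi) := ⟨ht.1, lt_of_le_of_ne ht.2 hne⟩
  have htm : t ∈ Set.uIcc 0 (2 * Real.pi) := by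
    rw [Set.uIcc_of_le h2pi]; exact ⟨ht.1.le, ht.2⟩
  have hg : IntervalIntegrable (fun θ => h θ - h t) volume 0 (2 * Real.pi) :=
    hh.sub intervalIntegrable_const
  have hd' : HasDerivAt (fun θ => ∫ s in t..θ, (h s - h t)) 0 t := by
    have h1 := (hd htm t htm).sub (((hasDerivAt_id t).sub_const t).mul_const (h t))
    simp only [one_mul, sub_self] at h1
    refine h1.congr_of_eventuallyEq ?_
    filter_upwards [Ioo_mem_nhds ht'.1 ht'.2] with θ hθ
    have hsub : Set.uIcc t θ ⊆ Set.uIcc 0 (2 * Real.pi) :=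
      Set.uIcc_subset_uIcc htm (by rw [Set.uIcc_of_le h2pi]; exact ⟨hθ.1.le, hθ.2.le⟩)
    rw [intervalIntegral.integral_sub (hh.mono_set hsub) intervalIntegrable_const]
    simp
  obtain ⟨c, hc⟩ := exists_abs_integral_unitPoissonKernel_mul_le hg ht' hd'
  have hlim : Tendsto (fun r : ℝ => ∫ θ in (0 : ℝ)..2 * Real.pi,
      unitPoissonKernel r (θ - t) * (h θ - h t)) (𝓝[<] 1) (𝓝 0) := by
    rw [Metric.tendsto_nhds]
    intro η hη
    obtain ⟨B, hB⟩ := hc (η / (2 * (|c| + 1))) (by positivity)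
    have hB0 : Tendsto (fun r : ℝ => B * (1 - r ^ 2)) (𝓝[<] 1) (𝓝 0) := by
      have : Continuous fun r : ℝ => B * (1 - r ^ 2) := by fun_prop
      simpa using (this.tendsto 1).mono_left nhdsWithin_le_nhds
    have hhalf : ∀ᶠ r : ℝ in 𝓝[<] 1, 1 / 2 ≤ r :=
      nhdsWithin_le_nhds (Ici_mem_nhds (by norm_num))
    filter_upwards [hB0.eventually_lt_const (half_pos hη), hhalf, self_mem_nhdsWithin]
      with r hr1 hr2 hr3
    rw [dist_zero_right, Real.norm_eq_abs]
    have h1 : c * (η / (2 * (|c| + 1))) ≤ η / 2 := by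
      rw [← mul_div_assoc, div_le_div_iff₀ (by positivity) (by norm_num)]
      nlinarith [le_abs_self c]
    linarith [hB r hr2 hr3]
  have hlim' := hlim.add_const (2 * Real.pi * h t)
  rw [zero_add] at hlim'
  refine hlim'.congr' ?_
  have hpos : ∀ᶠ r : ℝ in 𝓝[<] 1, 0 ≤ r := nhdsWithin_le_nhds (Ici_mem_nhds (by norm_num))
  filter_upwards [hpos, self_mem_nhdsWithin] with r hr0 hr1
  have hPc : Continuous fun θ => unitPoissonKernel r (θ - t) :=
    (contDiff_unitPoissonKernel hr0 hr1).continuous.comp (by fun_prop)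
  simp_rw [mul_sub]
  rw [intervalIntegral.integral_sub (hh.continuousOn_mul hPc.continuousOn)
    ((hPc.intervalIntegrable _ _).mul_const _), intervalIntegral.integral_mul_const,
    integral_unitPoissonKernel hr0 hr1]
  ring

/-! ### Bounded harmonic functions and their radial limits -/

lemma tendsto_circleMap_zero (r t : ℝ) :
    Tendsto (fun ρ : ℝ => circleMap 0 (ρ * r) t) (𝓝[<] 1) (𝓝 (circleMap 0 r t)) := by
  have : Continuous fun ρ : ℝ => circleMap 0 (ρ * r) t := by
    unfold circleMap; fun_prop
  simpa using (this.tendsto 1).mono_left nhdsWithin_le_nhds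

lemma eventually_mem_Ioo_nhdsLT_one : ∀ᶠ r : ℝ in 𝓝[<] 1, r ∈ Set.Ioo (0 : ℝ) 1 :=
  Ioo_mem_nhdsLT one_pos

lemma ContinuousOn.continuous_comp_circleMap {Y : Type*} [TopologicalSpace Y] {g : ℂ → Y}
    (hg : ContinuousOn g (Metric.ball 0 1)) {ρ : ℝ} (hρ : ρ ∈ Set.Ioo (0 : ℝ) 1) :
    Continuous fun θ => g (circleMap 0 ρ θ) :=
  hg.comp_continuous (continuous_circleMap 0 ρ) fun θ => circleMap_mem_unit_ball hρ.1.le hρ.2 θ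

/-- An almost everywhere defined radial limit of a continuous function on the disc is strongly
measurable. -/
lemma aestronglyMeasurable_of_radial_limit {Y : Type*} [TopologicalSpace Y]
    [TopologicalSpace.PseudoMetrizableSpace Y] {g : ℂ → Y}
    (hg : ContinuousOn g (Metric.ball 0 1)) {G : ℝ → Y} {μ : Measure ℝ}
    (hG : ∀ᵐ θ ∂μ, Tendsto (fun r : ℝ => g (circleMap 0 r θ)) (𝓝[<] 1) (𝓝 (G θ))) :
    AEStronglyMeasurable G μ := by
  obtain ⟨u, -, hu, hlim⟩ := exists_seq_strictMono_tendsto' (one_pos : (0 : ℝ) < 1)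
  have hlim' : Tendsto u atTop (𝓝[<] 1) :=
    tendsto_nhdsWithin_iff.2 ⟨hlim, Eventually.of_forall fun n => (hu n).2⟩
  refine aestronglyMeasurable_of_tendsto_ae atTop (f := fun n θ => g (circleMap 0 (u n) θ))
    (fun n => (hg.continuous_comp_circleMap (hu n)).aestronglyMeasurable) ?_
  filter_upwards [hG] with θ hθ using hθ.comp hlim'

/-- A bounded real harmonic function is the Poisson integral of its radial limits: pass to the limit
in the Poisson formula on the circles of radius `ρ < 1`, by dominated convergence. -/
lemma InnerProductSpace.HarmonicOnNhd.eq_integral_unitPoissonKernel_mul {u : ℂ → ℝ}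
    (hu : InnerProductSpace.HarmonicOnNhd u (Metric.ball 0 1)) {C : ℝ}
    (hC : ∀ z ∈ Metric.ball (0 : ℂ) 1, ‖u z‖ ≤ C) {U : ℝ → ℝ}
    (hU : ∀ᵐ θ ∂(volume.restrict (Set.Ioc 0 (2 * Real.pi))),
      Tendsto (fun r : ℝ => u (circleMap 0 r θ)) (𝓝[<] 1) (𝓝 (U θ)))
    {r : ℝ} (hr : 0 ≤ r) (hr1 : r < 1) (t : ℝ) :
    u (circleMap 0 r t) =
      (2 * Real.pi)⁻¹ * ∫ θ in (0 : ℝ)..2 * Real.pi, unitPoissonKernel r (θ - t) * U θ := by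
  have h2pi : (0 : ℝ) ≤ 2 * Real.pi := by positivity
  have hPc : Continuous fun θ => unitPoissonKernel r (θ - t) :=
    (contDiff_unitPoissonKernel hr hr1).continuous.comp (by fun_prop)
  have hball := circleMap_mem_unit_ball hr hr1 t
  have h1 : Tendsto (fun ρ : ℝ => u (circleMap 0 (ρ * r) t)) (𝓝[<] 1) (𝓝 (u (circleMap 0 r t))) :=
    ((hu.continuousOn.continuousAt (Metric.isOpen_ball.mem_nhds hball)).tendsto).comp
      (tendsto_circleMap_zero r t)
  have h2 : Tendsto (fun ρ : ℝ => (2 * Real.pi)⁻¹ * ∫ θ in (0 : ℝ)..2 * Real.pi,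
      unitPoissonKernel r (θ - t) * u (circleMap 0 ρ θ)) (𝓝[<] 1)
      (𝓝 ((2 * Real.pi)⁻¹ * ∫ θ in (0 : ℝ)..2 * Real.pi, unitPoissonKernel r (θ - t) * U θ)) := by
    refine Tendsto.const_mul _ ?_
    refine intervalIntegral.tendsto_integral_filter_of_dominated_convergence
      (fun θ => unitPoissonKernel r (θ - t) * C) ?_ ?_
      ((hPc.mul continuous_const).intervalIntegrable _ _) ?_
    · filter_upwards [eventually_mem_Ioo_nhdsLT_one] with ρ hρ
      exact (hPc.mul (hu.continuousOn.continuous_comp_circleMap hρ)).aestronglyMeasurable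
    · filter_upwards [eventually_mem_Ioo_nhdsLT_one] with ρ hρ
      refine Eventually.of_forall fun θ _ => ?_
      have hP := unitPoissonKernel_nonneg hr hr1 (θ - t)
      rw [norm_mul, Real.norm_of_nonneg hP]
      gcongr
      exact hC _ (circleMap_mem_unit_ball hρ.1.le hρ.2 θ)
    · rw [Set.uIoc_of_le h2pi]
      rw [ae_restrict_iff' measurableSet_Ioc] at hU
      filter_upwards [hU] with θ hθ hm using (hθ hm).const_mul _
  refine tendsto_nhds_unique (h1.congr' ?_) h2
  filter_upwards [eventually_mem_Ioo_nhdsLT_one] with ρ hρ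
  have hw : circleMap 0 (ρ * r) t ∈ Metric.ball (0 : ℂ) ρ := by
    have := hρ.1
    simp only [mem_ball_zero_iff, norm_circleMap_zero, abs_mul, abs_of_pos this, abs_of_nonneg hr]
    nlinarith
  rw [← InnerProductSpace.HarmonicOnNhd.circleAverage_poissonKernel_smul
    (hu.mono (Metric.closedBall_subset_ball hρ.2)) hw, Real.circleAverage_def]
  simp only [Pi.smul_apply', poissonKernel_circleMap_mul hρ.1.ne', smul_eq_mul]

/-- A bounded vector-valued harmonic function is dominated in norm by the Poisson integral of the
norms of its radial limits. This reduces to the scalar case through a norming functional, so no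
Bochner integral of the radial limits is needed. -/
lemma InnerProductSpace.HarmonicOnNhd.norm_le_integral_unitPoissonKernel_mul
    {Y : Type*} [NormedAddCommGroup Y] [NormedSpace ℝ Y] {g : ℂ → Y}
    (hg : InnerProductSpace.HarmonicOnNhd g (Metric.ball 0 1)) {C : ℝ}
    (hC : ∀ z ∈ Metric.ball (0 : ℂ) 1, ‖g z‖ ≤ C) {G : ℝ → Y}
    (hG : ∀ᵐ θ ∂(volume.restrict (Set.Ioc 0 (2 * Real.pi))),
      Tendsto (fun r : ℝ => g (circleMap 0 r θ)) (𝓝[<] 1) (𝓝 (G θ)))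
    {h : ℝ → ℝ} (hh : IntervalIntegrable h volume 0 (2 * Real.pi))
    (hGh : ∀ᵐ θ ∂(volume.restrict (Set.Ioc 0 (2 * Real.pi))), ‖G θ‖ ≤ h θ)
    {r : ℝ} (hr : 0 ≤ r) (hr1 : r < 1) (t : ℝ) :
    ‖g (circleMap 0 r t)‖ ≤
      (2 * Real.pi)⁻¹ * ∫ θ in (0 : ℝ)..2 * Real.pi, unitPoissonKernel r (θ - t) * h θ := by
  have h2pi : (0 : ℝ) ≤ 2 * Real.pi := by positivity
  have hPc : Continuous fun θ => unitPoissonKernel r (θ - t) :=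
    (contDiff_unitPoissonKernel hr hr1).continuous.comp (by fun_prop)
  obtain ⟨φ, hφ, hφg⟩ := exists_dual_vector'' ℝ (g (circleMap 0 r t))
  have hφle : ∀ y, ‖φ y‖ ≤ ‖y‖ := fun y => by
    simpa using φ.le_of_opNorm_le hφ y
  have hφG : ∀ᵐ θ ∂(volume.restrict (Set.Ioc 0 (2 * Real.pi))),
      Tendsto (fun r : ℝ => (φ ∘ g) (circleMap 0 r θ)) (𝓝[<] 1) (𝓝 (φ (G θ))) := by
    filter_upwards [hG] with θ hθ using (φ.continuous.tendsto _).comp hθ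
  have hrep := (hg.comp_CLM φ).eq_integral_unitPoissonKernel_mul
    (fun z hz => (hφle _).trans (hC z hz)) hφG hr hr1 t
  have hmeas := aestronglyMeasurable_of_radial_limit
    (hg.comp_CLM φ).continuousOn hφG
  have hφh : ∀ᵐ θ ∂(volume.restrict (Set.Ioc 0 (2 * Real.pi))), ‖φ (G θ)‖ ≤ h θ := by
    filter_upwards [hGh] with θ hθ using (hφle _).trans hθ
  have hint : IntervalIntegrable (fun θ => φ (G θ)) volume 0 (2 * Real.pi) := by
    rw [intervalIntegrable_iff_integrableOn_Ioc_of_le h2pi] at hh ⊢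
    exact Integrable.mono' hh hmeas hφh
  have : ‖g (circleMap 0 r t)‖ = (φ ∘ g) (circleMap 0 r t) := hφg.symm
  rw [this, hrep]
  gcongr
  refine intervalIntegral.integral_mono_ae_restrict h2pi (hint.continuousOn_mul hPc.continuousOn)
    (hh.continuousOn_mul hPc.continuousOn) ?_
  rw [← restrict_Ioc_eq_restrict_Icc]
  filter_upwards [hφh] with θ hθ
  exact mul_le_mul_of_nonneg_left ((le_abs_self _).trans hθ) (unitPoissonKernel_nonneg hr hr1 _)

section

variable {𝕜 : Type*} [RCLike 𝕜] {E F : Type*} [NormedAddCommGroup E] [NormedSpace 𝕜 E]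
  [NormedAddCommGroup F] [NormedSpace 𝕜 F]

lemma IsBoundedHarmonicOnDisc.continuousOn {f : ℂ → E} (hf : IsBoundedHarmonicOnDisc 𝕜 f) :
    ContinuousOn f (Metric.ball 0 1) := by
  let _ : NormedSpace ℝ E := NormedSpace.restrictScalars ℝ 𝕜 E
  exact InnerProductSpace.HarmonicOnNhd.continuousOn hf.1

lemma IsBoundedHarmonicOnDisc.sub_const {f : ℂ → E} (hf : IsBoundedHarmonicOnDisc 𝕜 f) (a : E) :
    IsBoundedHarmonicOnDisc 𝕜 fun z => f z - a := by
  let _ : NormedSpace ℝ E := NormedSpace.restrictScalars ℝ 𝕜 E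
  obtain ⟨hh, C, hC⟩ := hf
  exact ⟨InnerProductSpace.HarmonicOnNhd.sub hh (InnerProductSpace.harmonicOnNhd_const a),
    C + ‖a‖, fun z hz => (norm_sub_le _ _).trans (by gcongr; exact hC z hz)⟩

lemma IsBoundedHarmonicOnDisc.clm_comp {f : ℂ → E} (hf : IsBoundedHarmonicOnDisc 𝕜 f)
    (T : E →L[𝕜] F) : IsBoundedHarmonicOnDisc 𝕜 fun z => T (f z) := by
  let _ : NormedSpace ℝ E := NormedSpace.restrictScalars ℝ 𝕜 E
  let _ : NormedSpace ℝ F := NormedSpace.restrictScalars ℝ 𝕜 F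
  obtain ⟨hh, C, hC⟩ := hf
  let L : E →L[ℝ] F :=
    { toFun := T
      map_add' := T.map_add
      map_smul' := fun c x => T.map_smul (algebraMap ℝ 𝕜 c) x
      cont := T.continuous }
  exact ⟨InnerProductSpace.HarmonicOnNhd.comp_CLM hh L, ‖T‖ * C, fun z hz =>
    (T.le_opNorm _).trans (by gcongr; exact hC z hz)⟩

end

/-! ### Strong operator limits -/

section

variable {𝕜 : Type*} [RCLike 𝕜]
  {X : Type*} [NormedAddCommGroup X] [NormedSpace 𝕜 X]
  {Y : Type*} [NormedAddCommGroup Y] [NormedSpace 𝕜 Y]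

/-- A bounded family of operators that converges pointwise on a dense set converges pointwise
everywhere, to a bounded operator. -/
lemma ContinuousLinearMap.exists_tendsto_apply_of_dense [CompleteSpace Y] {ι : Type*} {l : Filter ι}
    [l.NeBot] {A : ι → X →L[𝕜] Y} {C : ℝ} (hA : ∀ᶠ i in l, ‖A i‖ ≤ C) {s : Set X} (hs : Dense s)
    (h : ∀ x ∈ s, ∃ y, Tendsto (fun i => A i x) l (𝓝 y)) :
    ∃ T : X →L[𝕜] Y, ∀ x, Tendsto (fun i => A i x) l (𝓝 (T x)) := by
  have hC : 0 ≤ C := by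
    obtain ⟨i, hi⟩ := hA.exists
    exact (norm_nonneg _).trans hi
  have hcauchy : ∀ x, ∃ y, Tendsto (fun i => A i x) l (𝓝 y) := by
    intro x
    refine cauchy_map_iff_exists_tendsto.1 (Metric.cauchy_iff.2 ⟨inferInstance, fun ε hε => ?_⟩)
    obtain ⟨x', hx', hxx'⟩ := hs.exists_dist_lt x (ε := ε / (4 * (C + 1))) (by positivity)
    obtain ⟨y, hy⟩ := h x' hx'
    refine ⟨Metric.ball y (ε / 2), ?_, fun a ha b hb => ?_⟩
    · rw [mem_map]
      filter_upwards [hA, Metric.tendsto_nhds.1 hy (ε / 4) (by positivity)] with i hi hi'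
      have h1 : dist (A i x) (A i x') ≤ ε / 4 := by
        rw [dist_eq_norm, ← map_sub]
        calc ‖A i (x - x')‖ ≤ C * ‖x - x'‖ := (A i).le_of_opNorm_le hi _
          _ ≤ (C + 1) * (ε / (4 * (C + 1))) := by
            rw [← dist_eq_norm]; gcongr; linarith
          _ = ε / 4 := by field_simp
      have := dist_triangle (A i x) (A i x') y
      simp only [Set.mem_preimage, Metric.mem_ball]
      linarith
    · have := dist_triangle_right a b y
      rw [Metric.mem_ball] at ha hb
      linarith
  choose T hT using hcauchy
  have hlim : Tendsto (fun i x => A i x) l (𝓝 T) := tendsto_pi_nhds.2 hT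
  refine ⟨(linearMapOfTendsto T (fun i => (A i : X →ₗ[𝕜] Y)) hlim).mkContinuous C fun x => ?_, hT⟩
  refine le_of_tendsto (hT x).norm ?_
  filter_upwards [hA] with i hi using (A i).le_of_opNorm_le hi x

/-- The operator norm is lower semicontinuous for the strong operator topology. -/
lemma ContinuousLinearMap.eventually_lt_norm_of_tendsto_apply {ι : Type*} {l : Filter ι}
    {A : ι → X →L[𝕜] Y} {T : X →L[𝕜] Y} (h : ∀ x, Tendsto (fun i => A i x) l (𝓝 (T x)))
    {c : ℝ} (hc : c < ‖T‖) : ∀ᶠ i in l, c < ‖A i‖ := by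
  by_contra hcon
  have hfreq : ∃ᶠ i in l, ‖A i‖ ≤ c := by
    simpa [Filter.not_eventually] using hcon
  refine hc.not_ge (T.opNorm_le_bound ?_ fun x => ?_)
  · obtain ⟨i, hi⟩ := hfreq.exists
    exact (norm_nonneg _).trans hi
  · exact le_of_tendsto_of_frequently (h x).norm
      (hfreq.mono fun i hi => (A i).le_of_opNorm_le hi x)

lemma ContinuousLinearMap.norm_eq_iSup_denseSeq [TopologicalSpace.SeparableSpace X]
    (T : X →L[𝕜] Y) :
    ‖T‖ = ⨆ n, ‖T (TopologicalSpace.denseSeq X n)‖ / ‖TopologicalSpace.denseSeq X n‖ := by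
  have hbdd : BddAbove (Set.range fun n =>
      ‖T (TopologicalSpace.denseSeq X n)‖ / ‖TopologicalSpace.denseSeq X n‖) := by
    refine ⟨‖T‖, ?_⟩
    rintro _ ⟨n, rfl⟩
    exact T.ratio_le_opNorm _
  refine le_antisymm (T.opNorm_le_bound (Real.iSup_nonneg fun n => by positivity) fun x => ?_)
    (ciSup_le fun n => T.ratio_le_opNorm _)
  refine (TopologicalSpace.denseRange_denseSeq X).induction_on (p := fun x => ‖T x‖ ≤ _ * ‖x‖) x
    (isClosed_le (by fun_prop) (by fun_prop)) fun n => ?_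
  by_cases h0 : TopologicalSpace.denseSeq X n = 0
  · simp [h0]
  · rw [← div_le_iff₀ (norm_pos_iff.2 h0)]
    exact le_ciSup hbdd n

/-- The norm of a strongly operator measurable function is measurable when the domain of the
operators is separable. -/
lemma aemeasurable_norm_clm [TopologicalSpace.SeparableSpace X] {α : Type*} [MeasurableSpace α]
    {μ : Measure α} {F : α → X →L[𝕜] Y} (hF : ∀ x, AEMeasurable (fun a => ‖F a x‖) μ) :
    AEMeasurable (fun a => ‖F a‖) μ := by
  simp_rw [ContinuousLinearMap.norm_eq_iSup_denseSeq]
  exact AEMeasurable.iSup fun n => (hF _).div_const _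

/-- Let a bounded operator-valued harmonic function have radial limits in the strong operator
topology. Then the norms converge radially too, to the norm of the limit. The upper bound is
Fatou's theorem for the Poisson integral that dominates the norm. -/
lemma ae_tendsto_norm_of_radial_limit_apply [TopologicalSpace.SeparableSpace X]
    {f : ℂ → X →L[𝕜] Y} (hf : IsBoundedHarmonicOnDisc 𝕜 f) {F : ℝ → X →L[𝕜] Y}
    (hF : ∀ᵐ t ∂(volume.restrict (Set.Ioc 0 (2 * Real.pi))),
      ∀ x, Tendsto (fun r : ℝ => f (circleMap 0 r t) x) (𝓝[<] 1) (𝓝 (F t x))) :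
    ∀ᵐ t ∂(volume.restrict (Set.Ioc 0 (2 * Real.pi))),
      Tendsto (fun r : ℝ => ‖f (circleMap 0 r t)‖) (𝓝[<] 1) (𝓝 ‖F t‖) := by
  have h2pi : (0 : ℝ) ≤ 2 * Real.pi := by positivity
  have hpi := Real.pi_pos
  obtain ⟨C, hC⟩ := hf.2
  have hfx : ∀ x, IsBoundedHarmonicOnDisc 𝕜 fun z => f z x := fun x =>
    hf.clm_comp (ContinuousLinearMap.apply 𝕜 Y x)
  have hFC : ∀ᵐ t ∂(volume.restrict (Set.Ioc 0 (2 * Real.pi))), ‖F t‖ ≤ C := by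
    filter_upwards [hF] with t ht
    by_contra hcon
    obtain ⟨r, hr, hr'⟩ := ((ContinuousLinearMap.eventually_lt_norm_of_tendsto_apply ht
      (not_le.1 hcon)).and eventually_mem_Ioo_nhdsLT_one).exists
    exact hr.not_ge (hC _ (circleMap_mem_unit_ball hr'.1.le hr'.2 t))
  have hmeas : AEMeasurable (fun t => ‖F t‖) (volume.restrict (Set.Ioc 0 (2 * Real.pi))) :=
    aemeasurable_norm_clm fun x => (aestronglyMeasurable_of_radial_limit (hfx x).continuousOn
      (hF.mono fun t ht => ht x)).norm.aemeasurable
  have hint : IntervalIntegrable (fun t => ‖F t‖) volume 0 (2 * Real.pi) := by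
    rw [intervalIntegrable_iff_integrableOn_Ioc_of_le h2pi]
    exact Integrable.mono' (integrable_const C) hmeas.aestronglyMeasurable (by simpa using hFC)
  have hupper : ∀ r : ℝ, 0 ≤ r → r < 1 → ∀ t, ‖f (circleMap 0 r t)‖ ≤ (2 * Real.pi)⁻¹ *
      ∫ θ in (0 : ℝ)..2 * Real.pi, unitPoissonKernel r (θ - t) * ‖F θ‖ := by
    intro r hr hr1 t
    refine ContinuousLinearMap.opNorm_le_bound _ ?_ fun x => ?_
    · refine mul_nonneg (by positivity) (intervalIntegral.integral_nonneg h2pi fun θ _ => ?_)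
      exact mul_nonneg (unitPoissonKernel_nonneg hr hr1 _) (norm_nonneg _)
    · let _ : NormedSpace ℝ Y := NormedSpace.restrictScalars ℝ 𝕜 Y
      obtain ⟨hh, C', hC'⟩ := hfx x
      have := InnerProductSpace.HarmonicOnNhd.norm_le_integral_unitPoissonKernel_mul hh hC'
        (hF.mono fun t ht => ht x) (hint.mul_const ‖x‖)
        (Eventually.of_forall fun θ => (F θ).le_opNorm x) hr hr1 t
      simpa only [← mul_assoc, intervalIntegral.integral_mul_const] using this
  filter_upwards [hF, ae_tendsto_integral_unitPoissonKernel_mul hint] with t ht hfatou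
  have hfatou' := hfatou.const_mul (2 * Real.pi)⁻¹
  rw [inv_mul_cancel_left₀ (by positivity)] at hfatou'
  refine tendsto_order.2 ⟨fun c hc => ContinuousLinearMap.eventually_lt_norm_of_tendsto_apply ht hc,
    fun c hc => ?_⟩
  filter_upwards [hfatou'.eventually_lt_const hc, eventually_mem_Ioo_nhdsLT_one] with r hr hr'
  exact (hupper r hr'.1.le hr'.2 t).trans_lt hr

/-- Almost everywhere, the radial limits exist in the strong operator topology. -/
lemma ae_exists_tendsto_apply [TopologicalSpace.SeparableSpace X] [CompleteSpace Y]
    (hY : HasRadonNikodymProperty 𝕜 Y) {f : ℂ → X →L[𝕜] Y} (hf : IsBoundedHarmonicOnDisc 𝕜 f) :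
    ∀ᵐ t ∂(volume.restrict (Set.Ioc 0 (2 * Real.pi))), ∃ T : X →L[𝕜] Y,
      ∀ x, Tendsto (fun r : ℝ => f (circleMap 0 r t) x) (𝓝[<] 1) (𝓝 (T x)) := by
  obtain ⟨C, hC⟩ := hf.2
  have h : ∀ n, ∀ᵐ t ∂(volume.restrict (Set.Ioc 0 (2 * Real.pi))), ∃ y, Tendsto
      (fun r : ℝ => f (circleMap 0 r t) (TopologicalSpace.denseSeq X n)) (𝓝[<] 1) (𝓝 y) :=
    fun n => by
      have hfn : IsBoundedHarmonicOnDisc 𝕜 fun z => f z (TopologicalSpace.denseSeq X n) :=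
        hf.clm_comp (ContinuousLinearMap.apply 𝕜 Y (TopologicalSpace.denseSeq X n))
      simpa only [ContinuousLinearMap.coe_id', id_eq] using hY _ hfn
  filter_upwards [ae_all_iff.2 h] with t ht
  refine ContinuousLinearMap.exists_tendsto_apply_of_dense (C := C) ?_
    (TopologicalSpace.denseRange_denseSeq X) (by rintro _ ⟨n, rfl⟩; exact ht n)
  filter_upwards [eventually_mem_Ioo_nhdsLT_one] with r hr
  exact hC _ (circleMap_mem_unit_ball hr.1.le hr.2 t)

/-! ### Weak local uniform rotundity -/

/-- In a weakly LUR space of operators, convergence in the strong operator topology together with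
convergence of the norms implies weak convergence. -/
lemma IsWeaklyLUR.tendsto_dual_of_tendsto_apply (hXY : IsWeaklyLUR 𝕜 (X →L[𝕜] Y))
    {A : ℕ → X →L[𝕜] Y} {T : X →L[𝕜] Y} (h : ∀ x, Tendsto (fun n => A n x) atTop (𝓝 (T x)))
    (hn : Tendsto (fun n => ‖A n‖) atTop (𝓝 ‖T‖)) (φ : StrongDual 𝕜 (X →L[𝕜] Y)) :
    Tendsto (fun n => φ (A n)) atTop (𝓝 (φ T)) := by
  -- Lower semicontinuity at `2 T` and the triangle inequality give `‖A n + T‖ → 2 ‖T‖`.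
  have hsum : Tendsto (fun n => ‖A n + T‖) atTop (𝓝 ‖T + T‖) := by
    have hTT : ‖T + T‖ = ‖T‖ + ‖T‖ := by rw [← two_smul 𝕜 T, norm_smul]; simp [two_mul]
    refine tendsto_order.2 ⟨fun c hc =>
      ContinuousLinearMap.eventually_lt_norm_of_tendsto_apply
        (fun x => by simpa using (h x).add_const (T x)) hc, fun c hc => ?_⟩
    rw [hTT] at hc
    filter_upwards [(hn.add_const ‖T‖).eventually_lt_const hc] with n hn
    exact (norm_add_le _ _).trans_lt hn
  obtain ⟨C, hC⟩ := hn.bddAbove_range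
  refine hXY T A ⟨C, fun n => hC ⟨n, rfl⟩⟩ ?_ φ
  have h1 : Tendsto (fun n => ‖(2 : 𝕜)⁻¹ • (A n + T)‖) atTop (𝓝 ‖T‖) := by
    simp_rw [norm_smul]
    have := hsum.const_mul ‖(2 : 𝕜)⁻¹‖
    rwa [← norm_smul, ← two_smul 𝕜 T, inv_smul_smul₀ two_ne_zero] at this
  have h2 := (((hn.pow 2).div_const 2).add_const (‖T‖ ^ 2 / 2)).sub (h1.pow 2)
  convert h2 using 2
  ring

/-- A closed subspace is weakly sequentially closed. -/
lemma Submodule.mem_of_tendsto_dual {E : Type*} [NormedAddCommGroup E] [NormedSpace 𝕜 E]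
    {Z : Submodule 𝕜 E} (hZ : IsClosed (Z : Set E)) {u : ℕ → E} (hu : ∀ᶠ n in atTop, u n ∈ Z) {x : E}
    (h : ∀ φ : StrongDual 𝕜 E, Tendsto (fun n => φ (u n)) atTop (𝓝 (φ x))) : x ∈ Z := by
  have : IsClosed (Z : Set E) := hZ
  let π : E →L[𝕜] E ⧸ Z := ⟨Z.mkQ, continuous_quot_mk⟩
  rw [← Submodule.Quotient.mk_eq_zero]
  refine SeparatingDual.eq_zero_of_forall_dual_eq_zero (R := 𝕜) fun ψ => ?_
  refine tendsto_nhds_unique (h (ψ.comp π)) (tendsto_const_nhds.congr' ?_)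
  filter_upwards [hu] with n hn
  have : π (u n) = 0 := (Submodule.Quotient.mk_eq_zero Z).2 hn
  simp [this]

end

theorem mainTheorem1 {𝕜 : Type*} [RCLike 𝕜]
    {X : Type*} [NormedAddCommGroup X] [NormedSpace 𝕜 X] [CompleteSpace X]
    [TopologicalSpace.SeparableSpace X]
    {Y : Type*} [NormedAddCommGroup Y] [NormedSpace 𝕜 Y] [CompleteSpace Y]
    (hY : HasRadonNikodymProperty 𝕜 Y)
    (hXY : IsWeaklyLUR 𝕜 (X →L[𝕜] Y)) :
    HasRadonNikodymProperty 𝕜 (X →L[𝕜] Y) := by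
  intro f hf
  simp only [ContinuousLinearMap.coe_id', id_eq]
  obtain ⟨F, hF⟩ := Filter.skolem.1 (ae_exists_tendsto_apply hY hf)
  set Z : Submodule 𝕜 (X →L[𝕜] Y) := (Submodule.span 𝕜 (f '' Metric.ball 0 1)).topologicalClosure
    with hZ
  -- `D` is countable and its closure contains `Z`; it need not be a subset of `Z`.
  obtain ⟨D, hD, hZD⟩ : TopologicalSpace.IsSeparable (Z : Set (X →L[𝕜] Y)) := by
    rw [hZ, Submodule.topologicalClosure_coe]
    exact (TopologicalSpace.IsSeparable.span (hf.continuousOn.isSeparable_image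
      (TopologicalSpace.IsSeparable.of_separableSpace _))).closure
  have hnorm := ae_tendsto_norm_of_radial_limit_apply hf hF
  have hnormD : ∀ᵐ t ∂(volume.restrict (Set.Ioc 0 (2 * Real.pi))), ∀ A ∈ D,
      Tendsto (fun r : ℝ => ‖f (circleMap 0 r t) - A‖) (𝓝[<] 1) (𝓝 ‖F t - A‖) := by
    refine (ae_ball_iff hD).2 fun A _ => ?_
    refine ae_tendsto_norm_of_radial_limit_apply (hf.sub_const A) (F := fun t => F t - A) ?_
    filter_upwards [hF] with t ht x using (ht x).sub_const (A x)
  obtain ⟨u, -, hu, hlim⟩ := exists_seq_strictMono_tendsto' (one_pos : (0 : ℝ) < 1)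
  have hlim' : Tendsto u atTop (𝓝[<] 1) :=
    tendsto_nhdsWithin_iff.2 ⟨hlim, Eventually.of_forall fun n => (hu n).2⟩
  filter_upwards [hF, hnorm, hnormD] with t ht hnt hntD
  have hFZ : F t ∈ Z := by
    refine Submodule.mem_of_tendsto_dual (Submodule.isClosed_topologicalClosure _)
      (u := fun n => f (circleMap 0 (u n) t)) (Eventually.of_forall fun n => ?_)
      (hXY.tendsto_dual_of_tendsto_apply (fun x => (ht x).comp hlim') (hnt.comp hlim'))
    exact Submodule.le_topologicalClosure _ (Submodule.subset_span
      ⟨_, circleMap_mem_unit_ball (hu n).1.le (hu n).2 t, rfl⟩)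
  -- For `A ∈ D` close to `F t`, the distance of `f` to `A` tends to `‖F t - A‖`, which is small.
  refine ⟨F t, Metric.tendsto_nhds.2 fun ε hε => ?_⟩
  obtain ⟨A, hA, hFA⟩ := Metric.mem_closure_iff.1 (hZD hFZ) (ε / 2) (half_pos hε)
  rw [dist_eq_norm] at hFA
  filter_upwards [(hntD A hA).eventually_lt_const hFA] with r hr
  calc dist (f (circleMap 0 r t)) (F t) ≤ dist (f (circleMap 0 r t)) A + dist (F t) A :=
        dist_triangle_right _ _ _
    _ < ε := by rw [dist_eq_norm, dist_eq_norm]; linarith
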